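/- **Theorem (Continuity of the entanglement distance).** For unit vectors $\psi,\varphi$ in a complex Hilbert space let $d_{\mathrm{FS}}(\psi,\varphi)=\arccos|\langle\psi|\varphi\rangle|$ be the Fubini–Study distance. Let $\mathcal H_A,\mathcal H_B$ be finite-dimensional complex Hilbert spaces. For a unit vector $\psi\in\mathcal H_A\otimes\mathcal H_B$ let $E(\psi)=-\operatorname{Tr}(\rho_A\log\rho_A)$, where $\rho_A=\operatorname{Tr}_B|\psi\rangle\langle\psi|$, $\log$ is the natural logarithm and $0\log 0=0$, be the entanglement entropy. For unit vectors $\psi,\varphi\in\mathcal H_A\otimes\mathcal H_B$ put $$d_E(\psi,\varphi)=\sqrt{d_{\mathrm{FS}}(\psi,\varphi)^2+|E(\psi)-E(\varphi)|^2}.$$ There is a universal constant $C>0$, independent of the spaces and of the states, such that for all finite-dimensional $\mathcal H_A,\mathcal H_B$ and all unit vectors $\psi,\chi,\varphi\in\mathcal H_A\otimes\mathcal H_B$, $$|d_E(\psi,\varphi)-d_E(\chi,\varphi)|\le d_{\mathrm{FS}}(\psi,\chi)+C\,d_{\mathrm{FS}}(\psi,\chi)\log d,\qquad d=\min(\dim\mathcal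 H_A,\dim\mathcal H_B).$$ In particular, for fixed $\mathcal H_A,\mathcal H_B$, there is a constant $K\ge 0$ with $|d_E(\psi,\varphi)-d_E(\chi,\varphi)|\le K\,d_{\mathrm{FS}}(\psi,\chi)$ for all unit vectors $\psi,\chi,\varphi$; that is, $d_E(\cdot,\varphi)$ is Lipschitz with respect to $d_{\mathrm{FS}}$, uniformly in $\varphi$. -/

import Mathlib

open scoped TensorProduct

noncomputable section

namespace QuantumDistance

section FubiniStudy

variable {H : Type*} [NormedAddCommGroup H] [InnerProductSpace ℂ H]

/-- The Fubini–Study distance `arccos (|⟨ψ|φ⟩| / (‖ψ‖ ‖φ‖))` between the rays of `ψ` and `φ`. -/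
def dFS (ψ φ : H) : ℝ :=
  Real.arccos (‖inner ℂ ψ φ‖ / (‖ψ‖ * ‖φ‖))

end FubiniStudy

section Entropy

variable {H : Type*} [NormedAddCommGroup H] [InnerProductSpace ℂ H] [FiniteDimensional ℂ H]

/-- The von Neumann entropy `S(ρ) = -Tr (ρ log ρ)` (natural logarithm) of an operator on a
finite-dimensional Hilbert space. The logarithm is the one of the functional calculus with the
convention `log 0 = 0`, so that eigenvalue `0` contributes `0 * log 0 = 0`. -/
def vonNeumannEntropy (ρ : H →L[ℂ] H) : ℝ :=
  haveI : CompleteSpace H := FiniteDimensional.complete ℂ H;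
  -(LinearMap.trace ℂ H (ρ * CFC.log ρ : H →L[ℂ] H)).re

end Entropy

section Bipartite

variable {A B : Type*}
  [NormedAddCommGroup A] [InnerProductSpace ℂ A] [FiniteDimensional ℂ A]
  [NormedAddCommGroup B] [InnerProductSpace ℂ B] [FiniteDimensional ℂ B]

variable (A B) in
/-- The partial trace over the second factor: under `End (A ⊗ B) ≃ End A ⊗ End B` it is
`id ⊗ Tr`, that is, the linear map with `S ⊗ T ↦ Tr T • S`. -/
def partialTrace : (A ⊗[ℂ] B →ₗ[ℂ] A ⊗[ℂ] B) →ₗ[ℂ] (A →ₗ[ℂ] A) :=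
  (TensorProduct.rid ℂ (A →ₗ[ℂ] A)).toLinearMap ∘ₗ
    LinearMap.lTensor (A →ₗ[ℂ] A) (LinearMap.trace ℂ B) ∘ₗ
      (homTensorHomEquiv ℂ A B A B).symm.toLinearMap

theorem partialTrace_map (S : A →ₗ[ℂ] A) (T : B →ₗ[ℂ] B) :
    partialTrace A B (TensorProduct.map S T) = LinearMap.trace ℂ B T • S := by
  have h : (homTensorHomEquiv ℂ A B A B).symm (TensorProduct.map S T) = S ⊗ₜ[ℂ] T := by
    rw [LinearEquiv.symm_apply_eq, homTensorHomEquiv_apply]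
    rfl
  simp [partialTrace, h]

/-- The reduced state `ρ_A = Tr_B |ψ⟩⟨ψ|`. -/
def reducedState (ψ : A ⊗[ℂ] B) : A →L[ℂ] A :=
  LinearMap.toContinuousLinearMap
    (partialTrace A B (InnerProductSpace.rankOne ℂ ψ ψ).toLinearMap)

/-- The entanglement entropy `E(ψ) = S(Tr_B |ψ⟩⟨ψ|)` of a unit vector `ψ`. -/
def entanglement (ψ : A ⊗[ℂ] B) : ℝ :=
  vonNeumannEntropy (reducedState ψ)

/-- The entanglement distance `√(d_FS(ψ,φ)² + |E(ψ) - E(φ)|²)` of unit vectors. -/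
def dE (ψ φ : A ⊗[ℂ] B) : ℝ :=
  Real.sqrt (dFS ψ φ ^ 2 + |entanglement ψ - entanglement φ| ^ 2)

end Bipartite

end QuantumDistance

end

/-!
Only the entropy part of `dE` needs work, since `dFS` is a metric on rays and the planar norm
satisfies the reverse triangle inequality. To bound `E(ψ) - E(χ)`, measure the first factor of both
states in an eigenbasis of the reduced state of `χ`. The outcome distribution of `χ` has Shannon
entropy exactly `E(χ)`, and by concavity of `-x log x` that of `ψ` has Shannon entropy at least
`E(ψ)`. The vectors of square roots of the outcome probabilities are unit vectors of `ℝⁿ`,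
`n = dim A`, and by Cauchy–Schwarz their angle, hence also their distance, is at most `dFS ψ χ`.
Finally `∑ -sᵢ² log sᵢ²` is `O(log n)`-Lipschitz on the unit sphere of `ℝⁿ`: the derivative
of `-s² log s²` is controlled by `s (1 - log s)`, which lies below the line `s log n + 1/n`, and
Cauchy–Schwarz applies to the sum over the coordinates. Since the two reduced states have the
same nonzero spectrum, `dim A` may be replaced by `min (dim A) (dim B)`.
-/

namespace QuantumDistance

section ShannonEntropy

open Real

theorem abs_negMulLog_sub_le {a b : ℝ} (ha : 0 ≤ a) (hab : a ≤ b) (hb : b ≤ 1) :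
    |negMulLog b - negMulLog a| ≤ (b - a) * (1 - log b) := by
  have hlog : a * log a ≤ a * log b ∧ a * (log b - log a) ≤ b - a := by
    rcases ha.eq_or_lt with rfl | ha
    · simpa using hab
    · refine ⟨by gcongr, ?_⟩
      have h := log_le_sub_one_of_pos (div_pos (ha.trans_le hab) ha)
      rw [log_div (ha.trans_le hab).ne' ha.ne'] at h
      calc a * (log b - log a) ≤ a * (b / a - 1) := by gcongr
        _ = b - a := by field_simp
  have hlogb : (b - a) * log b ≤ 0 :=
    mul_nonpos_of_nonneg_of_nonpos (sub_nonneg.2 hab) (log_nonpos (ha.trans hab) hb)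
  rw [negMulLog, negMulLog, abs_le]
  constructor <;> linarith

theorem negMulLog_add_self_le {x c : ℝ} (hx : 0 ≤ x) (hc : 0 < c) :
    negMulLog x + x ≤ x * log c + c⁻¹ := by
  have h := negMulLog_le_one_sub_self (mul_nonneg hx hc.le)
  rw [negMulLog_mul, show negMulLog c = -c * log c from rfl] at h
  refine le_of_mul_le_mul_left ?_ hc
  rw [mul_add c _ c⁻¹, mul_inv_cancel₀ hc.ne']
  linarith

theorem abs_negMulLog_sq_sub_le {x y c : ℝ} (hx : |x| ≤ 1) (hy : |y| ≤ 1) (hc : 1 ≤ c) :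
    |negMulLog (x ^ 2) - negMulLog (y ^ 2)| ≤
      4 * (|x - y| * ((|x| + |y|) * log c + c⁻¹)) := by
  wlog hxy : |y| ≤ |x| generalizing x y
  · rw [abs_sub_comm, abs_sub_comm x, add_comm |x|]
    exact this hy hx (le_of_not_ge hxy)
  have hlogx : log |x| ≤ 0 := log_nonpos (abs_nonneg x) hx
  have hfactor : x ^ 2 - y ^ 2 ≤ |x - y| * (2 * |x|) := by
    calc x ^ 2 - y ^ 2 = (|x| - |y|) * (|x| + |y|) := by rw [← sq_abs x, ← sq_abs y]; ring
      _ ≤ |x - y| * (2 * |x|) := by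
        gcongr
        · exact abs_sub_abs_le_abs_sub x y
        · linarith
  have htangent : |x| * (1 - log |x|) ≤ (|x| + |y|) * log c + c⁻¹ := by
    have h := negMulLog_add_self_le (abs_nonneg x) (zero_lt_one.trans_le hc)
    have hylog : 0 ≤ |y| * log c := mul_nonneg (abs_nonneg y) (log_nonneg hc)
    rw [negMulLog] at h
    linarith
  calc |negMulLog (x ^ 2) - negMulLog (y ^ 2)|
      ≤ (x ^ 2 - y ^ 2) * (1 - log (x ^ 2)) :=
        abs_negMulLog_sub_le (sq_nonneg y) (sq_le_sq.2 hxy) ((sq_le_one_iff_abs_le_one x).2 hx)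
    _ = (x ^ 2 - y ^ 2) * (1 - 2 * log |x|) := by rw [log_pow, log_abs, Nat.cast_ofNat]
    _ ≤ |x - y| * (2 * |x|) * (2 * (1 - log |x|)) := by gcongr <;> linarith
    _ = 4 * (|x - y| * (|x| * (1 - log |x|))) := by ring
    _ ≤ 4 * (|x - y| * ((|x| + |y|) * log c + c⁻¹)) := by gcongr

variable {ι : Type*} [Fintype ι]

/-- The Shannon entropy `-∑ pᵢ log pᵢ` (natural logarithm, `0 log 0 = 0`) of a finite family of
weights; the weights are not required to be a probability distribution. -/
noncomputable def shannonEntropy (p : ι → ℝ) : ℝ :=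
  ∑ i, negMulLog (p i)

theorem sum_abs_mul_abs_le_norm_mul_norm (u v : EuclideanSpace ℝ ι) :
    ∑ i, |u i| * |v i| ≤ ‖u‖ * ‖v‖ := by
  simpa only [EuclideanSpace.norm_eq, norm_eq_abs] using
    sum_mul_le_sqrt_mul_sqrt Finset.univ (fun i => |u i|) (fun i => |v i|)

theorem abs_shannonEntropy_sq_sub_le_two_mul_log_add_one [Nonempty ι] {s t : EuclideanSpace ℝ ι}
    (hs : ‖s‖ = 1) (ht : ‖t‖ = 1) :
    |shannonEntropy (fun i => s i ^ 2) - shannonEntropy (fun i => t i ^ 2)| ≤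
      4 * dist s t * (2 * log (Fintype.card ι) + 1) := by
  set n : ℝ := (Fintype.card ι : ℝ)
  have hn : 1 ≤ n := Nat.one_le_cast.2 Fintype.card_pos
  let uniform : EuclideanSpace ℝ ι := WithLp.toLp 2 fun _ => n⁻¹
  have huniform : ‖uniform‖ ≤ 1 := by
    have hsum : ∑ i, ‖uniform i‖ ^ 2 = n⁻¹ := by
      simp only [uniform, norm_eq_abs, sq_abs, Finset.sum_const, Finset.card_univ, nsmul_eq_mul]
      change n * n⁻¹ ^ 2 = n⁻¹
      field_simp
    rw [EuclideanSpace.norm_eq, hsum, sqrt_le_one]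
    exact inv_le_one_of_one_le₀ hn
  have hcs (v : EuclideanSpace ℝ ι) (hv : ‖v‖ ≤ 1) : ∑ i, |s i - t i| * |v i| ≤ dist s t :=
    (sum_abs_mul_abs_le_norm_mul_norm (s - t) v).trans
      ((mul_le_of_le_one_right (norm_nonneg _) hv).trans_eq (dist_eq_norm s t).symm)
  have hle (v : EuclideanSpace ℝ ι) (hv : ‖v‖ = 1) (i : ι) : |v i| ≤ 1 :=
    (PiLp.norm_apply_le v i).trans_eq hv
  calc |shannonEntropy (fun i => s i ^ 2) - shannonEntropy (fun i => t i ^ 2)|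
      ≤ ∑ i, |negMulLog (s i ^ 2) - negMulLog (t i ^ 2)| := by
        rw [shannonEntropy, shannonEntropy, ← Finset.sum_sub_distrib]
        exact Finset.abs_sum_le_sum_abs _ _
    _ ≤ ∑ i, 4 * (|s i - t i| * ((|s i| + |t i|) * log n + n⁻¹)) := by
        gcongr with i
        exact abs_negMulLog_sq_sub_le (hle s hs i) (hle t ht i) hn
    _ = 4 * ((∑ i, |s i - t i| * |s i| + ∑ i, |s i - t i| * |t i|) * log n +
          ∑ i, |s i - t i| * |uniform i|) := by
        rw [← Finset.sum_add_distrib, Finset.sum_mul, ← Finset.sum_add_distrib, Finset.mul_sum]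
        refine Finset.sum_congr rfl fun i _ => ?_
        rw [show |uniform i| = n⁻¹ from abs_of_nonneg (by positivity)]
        ring
    _ ≤ 4 * ((dist s t + dist s t) * log n + dist s t) := by
        gcongr
        exacts [hcs s hs.le, hcs t ht.le, hcs uniform huniform]
    _ = 4 * dist s t * (2 * log n + 1) := by ring

theorem abs_shannonEntropy_sq_sub_le {s t : EuclideanSpace ℝ ι} (hs : ‖s‖ = 1) (ht : ‖t‖ = 1) :
    |shannonEntropy (fun i => s i ^ 2) - shannonEntropy (fun i => t i ^ 2)| ≤
      16 * dist s t * log (Fintype.card ι) := by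
  rcases subsingleton_or_nontrivial ι with hι | hι
  · have hzero (v : EuclideanSpace ℝ ι) (hv : ‖v‖ = 1) : shannonEntropy (fun i => v i ^ 2) = 0 := by
      refine Finset.sum_eq_zero fun i _ => ?_
      have hvi : v i ^ 2 = 1 := by
        rw [← Fintype.sum_subsingleton (fun j => v j ^ 2) i, ← EuclideanSpace.real_norm_sq_eq, hv,
          one_pow]
      simp only [hvi, negMulLog_one]
    rw [hzero s hs, hzero t ht, sub_self, abs_zero]
    exact mul_nonneg (by positivity) (log_natCast_nonneg _)
  · have hcard : (2 : ℝ) ≤ Fintype.card ι := Nat.ofNat_le_cast.2 Fintype.one_lt_card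
    have hlog : 1 ≤ 2 * log (Fintype.card ι) := by
      linarith [log_le_log two_pos hcard, log_two_gt_d9]
    calc _ ≤ 4 * dist s t * (2 * log (Fintype.card ι) + 1) :=
          abs_shannonEntropy_sq_sub_le_two_mul_log_add_one hs ht
      _ ≤ 4 * dist s t * (2 * log (Fintype.card ι) + 2 * log (Fintype.card ι)) := by gcongr
      _ = 16 * dist s t * log (Fintype.card ι) := by ring

end ShannonEntropy

section FubiniStudyMetric

variable {H : Type*} [NormedAddCommGroup H] [InnerProductSpace ℂ H]

theorem dFS_comm (ψ φ : H) : dFS ψ φ = dFS φ ψ := by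
  rw [dFS, dFS, norm_inner_symm, mul_comm ‖ψ‖]

theorem dFS_smul_left {c : ℂ} (hc : ‖c‖ = 1) (ψ φ : H) : dFS (c • ψ) φ = dFS ψ φ := by
  rw [dFS, dFS, inner_smul_left, norm_mul, norm_smul, RCLike.norm_conj, hc, one_mul, one_mul]

theorem dFS_smul_right {c : ℂ} (hc : ‖c‖ = 1) (ψ φ : H) : dFS ψ (c • φ) = dFS ψ φ := by
  rw [dFS_comm, dFS_smul_left hc, dFS_comm]

section Angle

attribute [local instance] InnerProductSpace.complexToReal

open InnerProductGeometry

theorem dFS_le_angle (ψ φ : H) : dFS ψ φ ≤ angle ψ φ := by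
  refine Real.arccos_le_arccos ?_
  rw [real_inner_eq_re_inner ℂ]
  gcongr
  exact RCLike.re_le_norm _

theorem exists_angle_smul_right_eq_dFS (ψ φ : H) :
    ∃ c : ℂ, ‖c‖ = 1 ∧ angle ψ (c • φ) = dFS ψ φ := by
  obtain ⟨c, hc, h⟩ := RCLike.exists_norm_eq_mul_self (inner ℂ ψ φ)
  refine ⟨c, hc, ?_⟩
  rw [angle, dFS, real_inner_eq_re_inner ℂ, inner_smul_right, ← h, RCLike.ofReal_re, norm_smul, hc,
    one_mul]

theorem dFS_triangle (ψ χ φ : H) : dFS ψ φ ≤ dFS ψ χ + dFS χ φ := by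
  obtain ⟨c, hc, hψ⟩ := exists_angle_smul_right_eq_dFS χ ψ
  obtain ⟨e, he, hφ⟩ := exists_angle_smul_right_eq_dFS χ φ
  calc dFS ψ φ = dFS (c • ψ) (e • φ) := by rw [dFS_smul_left hc, dFS_smul_right he]
    _ ≤ angle (c • ψ) (e • φ) := dFS_le_angle _ _
    _ ≤ angle (c • ψ) χ + angle χ (e • φ) := angle_le_angle_add_angle _ _ _
    _ = dFS ψ χ + dFS χ φ := by rw [angle_comm, hψ, hφ, dFS_comm]

end Angle

theorem abs_dFS_sub_dFS_le (ψ χ φ : H) : |dFS ψ φ - dFS χ φ| ≤ dFS ψ χ := by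
  have hψ := dFS_triangle ψ χ φ
  have hχ := dFS_triangle χ ψ φ
  rw [dFS_comm χ ψ] at hχ
  exact abs_sub_le_iff.2 ⟨by linarith, by linarith⟩

end FubiniStudyMetric

theorem dist_le_angle_of_norm_eq_one {F : Type*} [NormedAddCommGroup F] [InnerProductSpace ℝ F]
    {x y : F} (hx : ‖x‖ = 1) (hy : ‖y‖ = 1) : dist x y ≤ InnerProductGeometry.angle x y := by
  refine le_of_sq_le_sq ?_ (InnerProductGeometry.angle_nonneg x y)
  have hcos := Real.one_sub_sq_div_two_le_cos (x := InnerProductGeometry.angle x y)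
  rw [InnerProductGeometry.cos_angle, hx, hy, mul_one, div_one] at hcos
  rw [dist_eq_norm, norm_sub_sq_real, hx, hy]
  linarith

section Entropy

variable {H : Type*} [NormedAddCommGroup H] [InnerProductSpace ℂ H]

theorem aeval_apply_of_apply_eq_smul {T : H →L[ℂ] H} {μ : ℝ} {v : H} (hv : T v = (μ : ℂ) • v)
    (p : Polynomial ℝ) : Polynomial.aeval T p v = ((p.eval μ : ℝ) : ℂ) • v := by
  induction p using Polynomial.induction_on with
  | C a => simp [Algebra.algebraMap_eq_smul_one]
  | add p q hp hq => simp [hp, hq, add_smul]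
  | monomial n a h =>
    rw [pow_succ, ← mul_assoc, map_mul, Polynomial.aeval_X, mul_apply_eq_comp, hv, map_smul, h,
      smul_smul, Polynomial.eval_mul_X, Complex.ofReal_mul, mul_comm]

theorem mem_spectrum_of_apply_eq_smul [CompleteSpace H] {T : H →L[ℂ] H} {μ : ℝ} {v : H}
    (hv : T v = (μ : ℂ) • v) (hv0 : v ≠ 0) : μ ∈ spectrum ℝ T := by
  intro hunit
  refine hv0 ((ContinuousLinearMap.isUnit_iff_bijective.1 hunit).1 ?_)
  simp [Algebra.algebraMap_eq_smul_one, hv]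

variable {ι : Type*} [Fintype ι] {ρ : H →L[ℂ] H}

theorem reApplyInnerSelf_eq_sum (e : OrthonormalBasis ι ℂ H) {μ : ι → ℝ}
    (he : ∀ k, ρ (e k) = (μ k : ℂ) • e k) (x : H) :
    ρ.reApplyInnerSelf x = ∑ k, ‖inner ℂ (e k) x‖ ^ 2 * μ k := by
  have hρx : ρ x = ∑ k, inner ℂ (e k) x • (μ k : ℂ) • e k := by
    conv_lhs => rw [← e.sum_repr' x]
    simp only [map_sum, map_smul, he]
  rw [ContinuousLinearMap.reApplyInnerSelf_apply, hρx, sum_inner, map_sum]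
  refine Finset.sum_congr rfl fun k _ => ?_
  rw [inner_smul_left, inner_smul_left, mul_left_comm, Complex.conj_mul', Complex.conj_ofReal,
    ← Complex.ofReal_pow, ← Complex.ofReal_mul, RCLike.re_to_complex, Complex.ofReal_re, mul_comm]

variable [FiniteDimensional ℂ H]

theorem finite_real_spectrum (T : H →L[ℂ] H) : (spectrum ℝ T).Finite := by
  have : CompleteSpace H := FiniteDimensional.complete ℂ H
  have hfin : (spectrum ℂ T).Finite := by
    refine (Module.End.finite_spectrum (T : H →ₗ[ℂ] H)).subset fun z hz hunit => hz ?_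
    exact ContinuousLinearMap.isUnit_iff_bijective.2 ((Module.End.isUnit_iff _).1 hunit)
  rw [← spectrum.preimage_algebraMap ℂ]
  exact hfin.preimage (FaithfulSMul.algebraMap_injective ℝ ℂ).injOn

theorem cfc_apply_of_apply_eq_smul [CompleteSpace H] (f : ℝ → ℝ) {T : H →L[ℂ] H}
    (hT : IsSelfAdjoint T) {μ : ℝ} {v : H} (hv : T v = (μ : ℂ) • v) :
    cfc f T v = (f μ : ℂ) • v := by
  rcases eq_or_ne v 0 with rfl | hv0
  · rw [map_zero, smul_zero]
  -- On the finite spectrum of `T` the function `f` agrees with an interpolation polynomial.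
  let p := Lagrange.interpolate (finite_real_spectrum T).toFinset id f
  have hp : (spectrum ℝ T).EqOn f p.eval := fun x hx =>
    (Lagrange.eval_interpolate_at_node f Function.injective_id.injOn
      ((finite_real_spectrum T).mem_toFinset.2 hx)).symm
  rw [cfc_congr hp, cfc_polynomial p T hT, aeval_apply_of_apply_eq_smul hv,
    hp (mem_spectrum_of_apply_eq_smul hv hv0)]

theorem vonNeumannEntropy_eq_shannonEntropy (hρ : (ρ : H →ₗ[ℂ] H).IsSymmetric)
    (e : OrthonormalBasis ι ℂ H) {μ : ι → ℝ} (he : ∀ i, ρ (e i) = (μ i : ℂ) • e i) :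
    vonNeumannEntropy ρ = shannonEntropy μ := by
  have : CompleteSpace H := FiniteDimensional.complete ℂ H
  have hρ' : IsSelfAdjoint ρ := ContinuousLinearMap.isSelfAdjoint_iff_isSymmetric.2 hρ
  have hlog (i : ι) : (ρ * CFC.log ρ) (e i) = ((μ i * Real.log (μ i) : ℝ) : ℂ) • e i := by
    rw [mul_apply_eq_comp, CFC.log, cfc_apply_of_apply_eq_smul _ hρ' (he i), map_smul, he,
      smul_smul, Complex.ofReal_mul, mul_comm]
  rw [vonNeumannEntropy, shannonEntropy, LinearMap.trace_eq_sum_inner _ e, Complex.re_sum,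
    ← Finset.sum_neg_distrib]
  refine Finset.sum_congr rfl fun i _ => ?_
  rw [ContinuousLinearMap.coe_coe, hlog, inner_smul_right, inner_self_eq_norm_sq_to_K,
    e.norm_eq_one, Real.negMulLog]
  simp

theorem vonNeumannEntropy_eq_shannonEntropy_reApplyInnerSelf (hρ : (ρ : H →ₗ[ℂ] H).IsSymmetric)
    (e : OrthonormalBasis ι ℂ H) {μ : ι → ℝ} (he : ∀ i, ρ (e i) = (μ i : ℂ) • e i) :
    vonNeumannEntropy ρ = shannonEntropy fun i => ρ.reApplyInnerSelf (e i) := by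
  refine vonNeumannEntropy_eq_shannonEntropy hρ e fun i => ?_
  rw [he, ContinuousLinearMap.reApplyInnerSelf_apply, he, inner_smul_left,
    inner_self_eq_norm_sq_to_K, e.norm_eq_one]
  simp

theorem vonNeumannEntropy_le_shannonEntropy_reApplyInnerSelf (hρ : ρ.IsPositive)
    (a : OrthonormalBasis ι ℂ H) :
    vonNeumannEntropy ρ ≤ shannonEntropy fun i => ρ.reApplyInnerSelf (a i) := by
  let e := hρ.isSymmetric.eigenvectorBasis rfl
  let μ := hρ.isSymmetric.eigenvalues rfl
  have he (k) : ρ (e k) = (μ k : ℂ) • e k := hρ.isSymmetric.apply_eigenvectorBasis rfl k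
  have hμ (k) : 0 ≤ μ k := hρ.toLinearMap.nonneg_eigenvalues rfl k
  -- The diagonal of `ρ` is a doubly stochastic image of its spectrum, so Jensen applies entrywise.
  have hrow (k) : ∑ i, ‖inner ℂ (e k) (a i)‖ ^ 2 = 1 := by
    rw [a.sum_sq_norm_inner_left, e.norm_eq_one, one_pow]
  have hcol (i : ι) : ∑ k, ‖inner ℂ (e k) (a i)‖ ^ 2 = 1 := by
    rw [e.sum_sq_norm_inner_right, a.norm_eq_one, one_pow]
  calc vonNeumannEntropy ρ
      = ∑ k, ∑ i, ‖inner ℂ (e k) (a i)‖ ^ 2 * Real.negMulLog (μ k) := by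
        simp only [vonNeumannEntropy_eq_shannonEntropy hρ.isSymmetric e he, shannonEntropy,
          ← Finset.sum_mul, hrow, one_mul]
    _ = ∑ i, ∑ k, ‖inner ℂ (e k) (a i)‖ ^ 2 * Real.negMulLog (μ k) := Finset.sum_comm
    _ ≤ shannonEntropy fun i => ρ.reApplyInnerSelf (a i) := by
        refine Finset.sum_le_sum fun i _ => ?_
        simp only [reApplyInnerSelf_eq_sum e he]
        exact Real.concaveOn_negMulLog.le_map_sum (fun k _ => sq_nonneg _) (hcol i)
          fun k _ => hμ k

theorem vonNeumannEntropy_eq_sum_roots_charpoly (hρ : (ρ : H →ₗ[ℂ] H).IsSymmetric) :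
    vonNeumannEntropy ρ =
      ((ρ : H →ₗ[ℂ] H).charpoly.roots.map fun z => Real.negMulLog z.re).sum := by
  rw [vonNeumannEntropy_eq_shannonEntropy hρ (hρ.eigenvectorBasis rfl)
    (hρ.apply_eigenvectorBasis rfl), hρ.roots_charpoly_eq_eigenvalues rfl, Multiset.map_map]
  simp [shannonEntropy, Finset.sum]

theorem sum_roots_X_pow_mul {R M : Type*} [CommRing R] [IsDomain R] [AddCommMonoid M] {f : R → M}
    (hf : f 0 = 0) (n : ℕ) {p : Polynomial R} (hp : p ≠ 0) :
    ((Polynomial.X ^ n * p).roots.map f).sum = (p.roots.map f).sum := by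
  rw [Polynomial.roots_mul (mul_ne_zero (pow_ne_zero _ Polynomial.X_ne_zero) hp),
    Polynomial.roots_X_pow, Multiset.map_add, Multiset.sum_add, Multiset.map_nsmul,
    Multiset.sum_nsmul, Multiset.map_singleton, Multiset.sum_singleton, hf, smul_zero, zero_add]

theorem vonNeumannEntropy_eq_of_X_pow_mul_charpoly_eq {K : Type*} [NormedAddCommGroup K]
    [InnerProductSpace ℂ K] [FiniteDimensional ℂ K] {σ : K →L[ℂ] K}
    (hρ : (ρ : H →ₗ[ℂ] H).IsSymmetric) (hσ : (σ : K →ₗ[ℂ] K).IsSymmetric) {m n : ℕ}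
    (h : Polynomial.X ^ m * (ρ : H →ₗ[ℂ] H).charpoly =
      Polynomial.X ^ n * (σ : K →ₗ[ℂ] K).charpoly) :
    vonNeumannEntropy ρ = vonNeumannEntropy σ := by
  have hzero : Real.negMulLog (0 : ℂ).re = 0 := Real.negMulLog_zero
  rw [vonNeumannEntropy_eq_sum_roots_charpoly hρ, vonNeumannEntropy_eq_sum_roots_charpoly hσ,
    ← sum_roots_X_pow_mul (f := fun z : ℂ => Real.negMulLog z.re) hzero m
      (LinearMap.charpoly_monic _).ne_zero, h,
    sum_roots_X_pow_mul (f := fun z : ℂ => Real.negMulLog z.re) hzero n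
      (LinearMap.charpoly_monic _).ne_zero]

end Entropy

section TensorFactorSwap

variable {A B : Type*} [NormedAddCommGroup A] [InnerProductSpace ℂ A]
  [NormedAddCommGroup B] [InnerProductSpace ℂ B] {ι κ : Type*} [Fintype ι] [Fintype κ]

theorem dFS_tensorProduct_comm (ψ χ : A ⊗[ℂ] B) :
    dFS (TensorProduct.comm ℂ A B ψ) (TensorProduct.comm ℂ A B χ) = dFS ψ χ := by
  rw [dFS, TensorProduct.inner_comm_comm, TensorProduct.norm_comm, TensorProduct.norm_comm, dFS]

/-- The matrix of coefficients of a bipartite vector in the product of two orthonormal bases; the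
rows are indexed by the basis of the first factor. -/
noncomputable def coeffMatrix (a : OrthonormalBasis ι ℂ A) (b : OrthonormalBasis κ ℂ B)
    (ψ : A ⊗[ℂ] B) : Matrix ι κ ℂ :=
  Matrix.of fun i j => inner ℂ (a i ⊗ₜ[ℂ] b j) ψ

theorem coeffMatrix_comm (a : OrthonormalBasis ι ℂ A) (b : OrthonormalBasis κ ℂ B)
    (ψ : A ⊗[ℂ] B) :
    coeffMatrix b a (TensorProduct.comm ℂ A B ψ) = (coeffMatrix a b ψ).transpose := by
  ext j i
  rw [coeffMatrix, Matrix.of_apply, ← TensorProduct.comm_tmul, TensorProduct.inner_comm_comm]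
  rfl

end TensorFactorSwap

section ReducedState

variable {A B : Type*}
  [NormedAddCommGroup A] [InnerProductSpace ℂ A] [FiniteDimensional ℂ A]
  [NormedAddCommGroup B] [InnerProductSpace ℂ B] [FiniteDimensional ℂ B]
  {ι κ : Type*} [Fintype ι] [Fintype κ]

theorem inner_partialTrace (b : OrthonormalBasis κ ℂ B) (T : A ⊗[ℂ] B →ₗ[ℂ] A ⊗[ℂ] B) (x y : A) :
    inner ℂ x (partialTrace A B T y) = ∑ j, inner ℂ (x ⊗ₜ[ℂ] b j) (T (y ⊗ₜ[ℂ] b j)) := by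
  obtain ⟨t, rfl⟩ := (homTensorHomEquiv ℂ A B A B).surjective T
  induction t with
  | zero => simp
  | add t u ht hu =>
    simp only [map_add, LinearMap.add_apply, inner_add_right, ht, hu, Finset.sum_add_distrib]
  | tmul S R =>
    have hmap : homTensorHomEquiv ℂ A B A B (S ⊗ₜ[ℂ] R) = TensorProduct.map S R := by
      rw [homTensorHomEquiv_apply]
      rfl
    rw [hmap, partialTrace_map, LinearMap.smul_apply, inner_smul_right,
      LinearMap.trace_eq_sum_inner R b, Finset.sum_mul]
    refine Finset.sum_congr rfl fun j _ => ?_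
    rw [TensorProduct.map_tmul, TensorProduct.inner_tmul, mul_comm]

theorem isPositive_partialTrace {T : A ⊗[ℂ] B →ₗ[ℂ] A ⊗[ℂ] B} (hT : T.IsPositive) :
    (partialTrace A B T).IsPositive := by
  have b := stdOrthonormalBasis ℂ B
  have hinner (x y : A) : inner ℂ (partialTrace A B T x) y =
      ∑ j, inner ℂ (T (x ⊗ₜ[ℂ] b j)) (y ⊗ₜ[ℂ] b j) := by
    rw [← inner_conj_symm, inner_partialTrace b, map_sum]
    exact Finset.sum_congr rfl fun j _ => inner_conj_symm (𝕜 := ℂ) (E := A ⊗[ℂ] B) _ _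
  refine ⟨fun x y => ?_, fun x => ?_⟩
  · rw [hinner, inner_partialTrace b]
    exact Finset.sum_congr rfl fun j _ => hT.isSymmetric _ _
  · rw [hinner, map_sum]
    exact Finset.sum_nonneg fun j _ => hT.re_inner_nonneg_left _

theorem isPositive_reducedState (ψ : A ⊗[ℂ] B) : (reducedState ψ).IsPositive :=
  (ContinuousLinearMap.isPositive_toLinearMap_iff _).1 <|
    isPositive_partialTrace (InnerProductSpace.isPositive_rankOne_self ψ).toLinearMap

theorem inner_reducedState (b : OrthonormalBasis κ ℂ B) (ψ : A ⊗[ℂ] B) (x y : A) :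
    inner ℂ x (reducedState ψ y) =
      ∑ j, inner ℂ (x ⊗ₜ[ℂ] b j) ψ * inner ℂ ψ (y ⊗ₜ[ℂ] b j) := by
  refine (inner_partialTrace b _ x y).trans (Finset.sum_congr rfl fun j _ => ?_)
  rw [ContinuousLinearMap.coe_coe, InnerProductSpace.rankOne_apply, inner_smul_right, mul_comm]

theorem reApplyInnerSelf_reducedState (b : OrthonormalBasis κ ℂ B) (ψ : A ⊗[ℂ] B) (x : A) :
    (reducedState ψ).reApplyInnerSelf x = ∑ j, ‖inner ℂ (x ⊗ₜ[ℂ] b j) ψ‖ ^ 2 := by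
  rw [ContinuousLinearMap.reApplyInnerSelf_apply, inner_re_symm, inner_reducedState b, map_sum]
  refine Finset.sum_congr rfl fun j _ => ?_
  rw [← inner_conj_symm ψ, RCLike.mul_conj]
  norm_cast

theorem toMatrix_reducedState [DecidableEq ι] (a : OrthonormalBasis ι ℂ A)
    (b : OrthonormalBasis κ ℂ B) (ψ : A ⊗[ℂ] B) :
    LinearMap.toMatrix a.toBasis a.toBasis (reducedState ψ : A →ₗ[ℂ] A) =
      coeffMatrix a b ψ * (coeffMatrix a b ψ).conjTranspose := by
  ext i j
  rw [LinearMap.toMatrix_apply, Matrix.mul_apply, OrthonormalBasis.coe_toBasis_repr_apply,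
    OrthonormalBasis.repr_apply_apply, OrthonormalBasis.coe_toBasis, ContinuousLinearMap.coe_coe,
    inner_reducedState b]
  refine Finset.sum_congr rfl fun k _ => ?_
  rw [← inner_conj_symm ψ]
  rfl

theorem entanglement_comm (ψ : A ⊗[ℂ] B) :
    entanglement (TensorProduct.comm ℂ A B ψ) = entanglement ψ := by
  let a := stdOrthonormalBasis ℂ A
  let b := stdOrthonormalBasis ℂ B
  let M := coeffMatrix a b ψ
  have hA : (reducedState ψ : A →ₗ[ℂ] A).charpoly = (M * M.conjTranspose).charpoly := by
    rw [← LinearMap.charpoly_toMatrix _ a.toBasis, toMatrix_reducedState a b]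
  have hB : (reducedState (TensorProduct.comm ℂ A B ψ) : B →ₗ[ℂ] B).charpoly =
      (M.conjTranspose * M).charpoly := by
    rw [← LinearMap.charpoly_toMatrix _ b.toBasis, toMatrix_reducedState b a, coeffMatrix_comm,
      ← Matrix.charpoly_transpose, Matrix.transpose_mul, Matrix.transpose_transpose]
    rfl
  have hcharpoly := Matrix.charpoly_mul_comm' M M.conjTranspose
  rw [← hA, ← hB] at hcharpoly
  exact (vonNeumannEntropy_eq_of_X_pow_mul_charpoly_eq (isPositive_reducedState ψ).isSymmetric
    (isPositive_reducedState _).isSymmetric hcharpoly).symm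

/-- The vector of square roots of the outcome probabilities when the first factor of the state `ψ`
is measured in the orthonormal basis `a`. -/
noncomputable def localAmplitude (a : OrthonormalBasis ι ℂ A) (ψ : A ⊗[ℂ] B) :
    EuclideanSpace ℝ ι :=
  WithLp.toLp 2 fun i => √((reducedState ψ).reApplyInnerSelf (a i))

theorem localAmplitude_apply (a : OrthonormalBasis ι ℂ A) (b : OrthonormalBasis κ ℂ B)
    (ψ : A ⊗[ℂ] B) (i : ι) :
    localAmplitude a ψ i = √(∑ j, ‖inner ℂ (a i ⊗ₜ[ℂ] b j) ψ‖ ^ 2) := by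
  rw [← reApplyInnerSelf_reducedState]
  rfl

theorem localAmplitude_apply_sq (a : OrthonormalBasis ι ℂ A) (ψ : A ⊗[ℂ] B) (i : ι) :
    localAmplitude a ψ i ^ 2 = (reducedState ψ).reApplyInnerSelf (a i) :=
  Real.sq_sqrt ((isPositive_reducedState ψ).2 (a i))

theorem norm_localAmplitude (a : OrthonormalBasis ι ℂ A) (ψ : A ⊗[ℂ] B) :
    ‖localAmplitude a ψ‖ = ‖ψ‖ := by
  have b := stdOrthonormalBasis ℂ B
  rw [← sq_eq_sq₀ (norm_nonneg _) (norm_nonneg _), EuclideanSpace.real_norm_sq_eq,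
    ← (a.tensorProduct b).sum_sq_norm_inner_right ψ, Fintype.sum_prod_type]
  simp only [localAmplitude_apply_sq, reApplyInnerSelf_reducedState b,
    OrthonormalBasis.tensorProduct_apply]

theorem norm_inner_le_inner_localAmplitude (a : OrthonormalBasis ι ℂ A) (ψ χ : A ⊗[ℂ] B) :
    ‖inner ℂ ψ χ‖ ≤ inner ℝ (localAmplitude a ψ) (localAmplitude a χ) := by
  have b := stdOrthonormalBasis ℂ B
  calc ‖inner ℂ ψ χ‖
      = ‖∑ i, ∑ j, inner ℂ ψ (a i ⊗ₜ[ℂ] b j) * inner ℂ (a i ⊗ₜ[ℂ] b j) χ‖ := by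
        rw [← (a.tensorProduct b).sum_inner_mul_inner ψ χ, Fintype.sum_prod_type]
        simp only [OrthonormalBasis.tensorProduct_apply]
    _ ≤ ∑ i, ∑ j, ‖inner ℂ (a i ⊗ₜ[ℂ] b j) ψ‖ * ‖inner ℂ (a i ⊗ₜ[ℂ] b j) χ‖ := by
        refine norm_sum_le_of_le _ fun i _ => norm_sum_le_of_le _ fun j _ => ?_
        rw [norm_mul, norm_inner_symm ψ]
    _ ≤ ∑ i, localAmplitude a ψ i * localAmplitude a χ i := by
        simp only [localAmplitude_apply a b]
        gcongr with i
        exact Real.sum_mul_le_sqrt_mul_sqrt _ _ _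
    _ = inner ℝ (localAmplitude a ψ) (localAmplitude a χ) := by
        simp only [PiLp.inner_apply, RCLike.inner_apply', conj_trivial]

theorem angle_localAmplitude_le_dFS (a : OrthonormalBasis ι ℂ A) (ψ χ : A ⊗[ℂ] B) :
    InnerProductGeometry.angle (localAmplitude a ψ) (localAmplitude a χ) ≤ dFS ψ χ := by
  refine Real.arccos_le_arccos ?_
  rw [norm_localAmplitude, norm_localAmplitude]
  gcongr
  exact norm_inner_le_inner_localAmplitude a ψ χ

theorem dist_localAmplitude_le_dFS (a : OrthonormalBasis ι ℂ A) {ψ χ : A ⊗[ℂ] B}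
    (hψ : ‖ψ‖ = 1) (hχ : ‖χ‖ = 1) :
    dist (localAmplitude a ψ) (localAmplitude a χ) ≤ dFS ψ χ :=
  (dist_le_angle_of_norm_eq_one ((norm_localAmplitude a ψ).trans hψ)
    ((norm_localAmplitude a χ).trans hχ)).trans (angle_localAmplitude_le_dFS a ψ χ)

theorem entanglement_sub_le_finrank_left {ψ χ : A ⊗[ℂ] B} (hψ : ‖ψ‖ = 1) (hχ : ‖χ‖ = 1) :
    entanglement ψ - entanglement χ ≤ 16 * dFS ψ χ * Real.log (Module.finrank ℂ A) := by
  have hsymm := (isPositive_reducedState χ).isSymmetric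
  let a := hsymm.eigenvectorBasis rfl
  let measuredEntropy (φ : A ⊗[ℂ] B) : ℝ := shannonEntropy fun i => localAmplitude a φ i ^ 2
  have hψE : entanglement ψ ≤ measuredEntropy ψ := by
    simp only [measuredEntropy, localAmplitude_apply_sq]
    exact vonNeumannEntropy_le_shannonEntropy_reApplyInnerSelf (isPositive_reducedState ψ) a
  have hχE : entanglement χ = measuredEntropy χ := by
    simp only [measuredEntropy, localAmplitude_apply_sq]
    exact vonNeumannEntropy_eq_shannonEntropy_reApplyInnerSelf hsymm a
      (hsymm.apply_eigenvectorBasis rfl)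
  calc entanglement ψ - entanglement χ ≤ |measuredEntropy ψ - measuredEntropy χ| := by
        rw [hχE]
        exact (sub_le_sub_right hψE _).trans (le_abs_self _)
    _ ≤ 16 * dist (localAmplitude a ψ) (localAmplitude a χ) * Real.log (Module.finrank ℂ A) := by
        simpa only [Fintype.card_fin] using abs_shannonEntropy_sq_sub_le
          ((norm_localAmplitude a ψ).trans hψ) ((norm_localAmplitude a χ).trans hχ)
    _ ≤ 16 * dFS ψ χ * Real.log (Module.finrank ℂ A) := by
        gcongr
        exact dist_localAmplitude_le_dFS a hψ hχ

theorem entanglement_sub_le {ψ χ : A ⊗[ℂ] B} (hψ : ‖ψ‖ = 1) (hχ : ‖χ‖ = 1) :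
    entanglement ψ - entanglement χ ≤
      16 * dFS ψ χ * Real.log (min (Module.finrank ℂ A) (Module.finrank ℂ B) : ℕ) := by
  rcases min_choice (Module.finrank ℂ A) (Module.finrank ℂ B) with hmin | hmin
  · rw [hmin]
    exact entanglement_sub_le_finrank_left hψ hχ
  · rw [hmin, ← entanglement_comm ψ, ← entanglement_comm χ, ← dFS_tensorProduct_comm]
    exact entanglement_sub_le_finrank_left ((TensorProduct.norm_comm ψ).trans hψ)
      ((TensorProduct.norm_comm χ).trans hχ)

theorem abs_entanglement_sub_le {ψ χ : A ⊗[ℂ] B} (hψ : ‖ψ‖ = 1) (hχ : ‖χ‖ = 1) :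
    |entanglement ψ - entanglement χ| ≤
      16 * dFS ψ χ * Real.log (min (Module.finrank ℂ A) (Module.finrank ℂ B) : ℕ) :=
  abs_sub_le_iff.2 ⟨entanglement_sub_le hψ hχ, dFS_comm χ ψ ▸ entanglement_sub_le hχ hψ⟩

end ReducedState

section EntanglementDistance

theorem abs_sqrt_sq_add_sq_sub_le (a b a' b' : ℝ) :
    |√(a ^ 2 + b ^ 2) - √(a' ^ 2 + b' ^ 2)| ≤ |a - a'| + |b - b'| := by
  have hnorm (x y : ℝ) : ‖(⟨x, y⟩ : ℂ)‖ = √(x ^ 2 + y ^ 2) := by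
    rw [Complex.norm_def, Complex.normSq_mk, sq, sq]
  rw [← hnorm, ← hnorm]
  exact (abs_norm_sub_norm_le _ _).trans (Complex.norm_le_abs_re_add_abs_im _)

variable {A B : Type*}
  [NormedAddCommGroup A] [InnerProductSpace ℂ A] [FiniteDimensional ℂ A]
  [NormedAddCommGroup B] [InnerProductSpace ℂ B] [FiniteDimensional ℂ B]

theorem abs_dE_sub_dE_le {ψ χ : A ⊗[ℂ] B} (hψ : ‖ψ‖ = 1) (hχ : ‖χ‖ = 1) (φ : A ⊗[ℂ] B) :
    |dE ψ φ - dE χ φ| ≤ dFS ψ χ + 16 * dFS ψ χ *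
      Real.log (min (Module.finrank ℂ A) (Module.finrank ℂ B) : ℕ) := by
  refine (abs_sqrt_sq_add_sq_sub_le _ _ _ _).trans
    (add_le_add (abs_dFS_sub_dFS_le ψ χ φ) ((abs_abs_sub_abs_le _ _).trans ?_))
  rw [sub_sub_sub_cancel_right]
  exact abs_entanglement_sub_le hψ hχ

end EntanglementDistance

end QuantumDistance

open scoped TensorProduct in
theorem mainTheorem9 :
    ∃ C : ℝ, 0 < C ∧
      ∀ (A : Type*) (B : Type*)
        [NormedAddCommGroup A] [InnerProductSpace ℂ A] [FiniteDimensional ℂ A]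
        [NormedAddCommGroup B] [InnerProductSpace ℂ B] [FiniteDimensional ℂ B],
        (∀ ψ χ φ : A ⊗[ℂ] B, ‖ψ‖ = 1 → ‖χ‖ = 1 → ‖φ‖ = 1 →
          |QuantumDistance.dE ψ φ - QuantumDistance.dE χ φ| ≤
            QuantumDistance.dFS ψ χ + C * QuantumDistance.dFS ψ χ *
              Real.log (min (Module.finrank ℂ A) (Module.finrank ℂ B) : ℕ)) ∧
        (∃ K : ℝ, 0 ≤ K ∧ ∀ ψ χ φ : A ⊗[ℂ] B, ‖ψ‖ = 1 → ‖χ‖ = 1 → ‖φ‖ = 1 →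
          |QuantumDistance.dE ψ φ - QuantumDistance.dE χ φ| ≤
            K * QuantumDistance.dFS ψ χ) := by
  refine ⟨16, by norm_num, fun A B _ _ _ _ _ _ => ⟨fun ψ χ φ hψ hχ _ =>
    QuantumDistance.abs_dE_sub_dE_le hψ hχ φ, ?_⟩⟩
  let d : ℕ := min (Module.finrank ℂ A) (Module.finrank ℂ B)
  refine ⟨1 + 16 * Real.log d, by positivity, fun ψ χ φ hψ hχ _ => ?_⟩
  calc |QuantumDistance.dE ψ φ - QuantumDistance.dE χ φ|
      ≤ QuantumDistance.dFS ψ χ + 16 * QuantumDistance.dFS ψ χ * Real.log d :=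
        QuantumDistance.abs_dE_sub_dE_le hψ hχ φ
    _ = (1 + 16 * Real.log d) * QuantumDistance.dFS ψ χ := by ring
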